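/- Words are finite words over the positive integers $\mathbb P=\{1,2,3,\dots\}$. Two words differ by a Knuth transposition if they are, in some order, $xacby$ and $xcaby$ with letters $a\le b<c$, or $xbacy$ and $xbcay$ with letters $a<b\le c$, where $x,y$ are words. Two words are Knuth-equivalent, written $v\equiv w$, if one is obtained from the other by a finite (possibly empty) sequence of Knuth transpositions. For a word $u$ let $C(u)=\{w : uw\equiv wu\}$, and let $c_{n,m}(u)$ be the number of words $w\in C(u)$ of length $n$ all of whose letters are at most $m$. A word is Yamanouchi if, for all $i\ge 1$, each of its suffixes contains at least as many letters $i$ as letters $i+1$. Then for all $n\ge 0$, writing $1$ and $2$ for the corresponding one-letter words, $$c_{n,2}(1)=c_{n,2}(2)=\binom{n}{\lfloor n/2\rfloor},$$ and this is also the number of Yamanouchi words in $[2]^n=\{1,2\}^n$. -/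

import Mathlib

namespace KnuthCentralizer

/-- A word over the positive integers. -/
abbrev Word : Type := List ℕ+

/-- An elementary Knuth move: either `x a c b y ↦ x c a b y` with `a ≤ b < c`, or
`x b a c y ↦ x b c a y` with `a < b ≤ c`. The inverse moves are obtained in `KnuthEquiv`. -/
inductive KnuthTransposition : Word → Word → Prop
  | first (x y : Word) (a b c : ℕ+) (hab : a ≤ b) (hbc : b < c) :
      KnuthTransposition (x ++ [a, c, b] ++ y) (x ++ [c, a, b] ++ y)
  | second (x y : Word) (a b c : ℕ+) (hab : a < b) (hbc : b ≤ c) :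
      KnuthTransposition (x ++ [b, a, c] ++ y) (x ++ [b, c, a] ++ y)

/-- Knuth equivalence: the equivalence relation generated by the Knuth transpositions. -/
def KnuthEquiv : Word → Word → Prop :=
  Relation.EqvGen KnuthTransposition

/-- The centralizer `C(u)`: all words `w` such that `uw` and `wu` are Knuth-equivalent. -/
def centralizer (u : Word) : Set Word :=
  {w | KnuthEquiv (u ++ w) (w ++ u)}

/-- The set `[m]^n` of words of length `n` all of whose letters are at most `m`. -/
def words (n m : ℕ) : Set Word :=
  {w | w.length = n ∧ ∀ a ∈ w, (a : ℕ) ≤ m}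

/-- `c_{n,m}(u)`: the number of words of length `n` in `C(u)` with all letters at most `m`. -/
noncomputable def centralizerCount (n m : ℕ) (u : Word) : ℕ :=
  (centralizer u ∩ words n m).ncard

/-- A word is Yamanouchi if each of its suffixes has, for every `i ≥ 1`, at least as many
letters `i` as letters `i + 1`. -/
def IsYamanouchi (w : Word) : Prop :=
  ∀ s : Word, s <:+ w → ∀ i : ℕ+, s.count (i + 1) ≤ s.count i

end KnuthCentralizer

/-! The weight (number of `2`s minus number of `1`s) and the height (largest suffix weight, empty
suffix included) are Knuth invariants. On the alphabet `{1, 2}` the factor `21` commutes with both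
letters up to equivalence, so every word is equivalent to some `(21)^k 1^i 2^j`; the invariants
recover `j` as the height and `i` as height minus weight, the "depth". Comparing the heights of `uw`
and `wu` shows that commuting with `1` forces `j = 0` and commuting with `2` forces `i = 0`;
conversely those normal forms visibly commute with the letter. Height zero is the Yamanouchi
condition.

It remains to count words of depth zero, and of height zero by a symmetry. Prepending a letter moves
the depth like a walk on the nonnegative integers that stays put when it tries to leave `0`;
Pascal's rule then gives the number of such walks by endpoint. -/

namespace KnuthCentralizer

/-! ### Two statistics on words, ignoring all letters other than `1` and `2` -/

/-- The letter `1` weighs `-1`, the letter `2` weighs `1`, all others `0`. -/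
def letterWeight (a : ℕ+) : ℤ := if a = 1 then -1 else if a = 2 then 1 else 0

@[simp] theorem letterWeight_one : letterWeight 1 = -1 := by decide
@[simp] theorem letterWeight_two : letterWeight 2 = 1 := by decide

/-- The number of letters `2` minus the number of letters `1`. -/
def weight : Word → ℤ
  | [] => 0
  | a :: w => letterWeight a + weight w

/-- The largest weight of a suffix. -/
def height : Word → ℤ
  | [] => 0
  | a :: w => max (height w) (letterWeight a + weight w)

@[simp] theorem weight_nil : weight [] = 0 := rfl
@[simp] theorem weight_cons (a : ℕ+) (w : Word) :
    weight (a :: w) = letterWeight a + weight w := rfl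
@[simp] theorem height_nil : height [] = 0 := rfl
@[simp] theorem height_cons (a : ℕ+) (w : Word) :
    height (a :: w) = max (height w) (letterWeight a + weight w) := rfl

@[simp] theorem weight_append (u v : Word) : weight (u ++ v) = weight u + weight v := by
  induction u with
  | nil => simp
  | cons a u ih => simp [ih, add_assoc]

theorem height_nonneg (w : Word) : 0 ≤ height w := by
  induction w with
  | nil => simp
  | cons a w ih => exact le_max_of_le_left ih

theorem weight_le_height (w : Word) : weight w ≤ height w := by
  cases w with
  | nil => simp
  | cons a w => exact le_max_right _ _

theorem height_append (u v : Word) :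
    height (u ++ v) = max (height v) (height u + weight v) := by
  induction u with
  | nil =>
    have := weight_le_height v
    simp [this]
  | cons a u ih =>
    simp only [List.cons_append, height_cons, weight_append, ih]
    omega

theorem weight_eq_count_sub_count (w : Word) : weight w = w.count 2 - w.count 1 := by
  induction w with
  | nil => simp
  | cons a w ih =>
    have h12 : (1 : ℕ+) ≠ 2 := by decide
    rw [weight_cons, ih, List.count_cons, List.count_cons, letterWeight]
    by_cases h1 : a = 1
    · subst h1
      simp [h12]
      ring
    · by_cases h2 : a = 2
      · subst h2
        simp [h12.symm]
        ring
      · simp [h1, h2]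

theorem height_le_zero_iff (w : Word) : height w ≤ 0 ↔ ∀ s, s <:+ w → weight s ≤ 0 := by
  induction w with
  | nil => simp
  | cons a w ih =>
    simp only [height_cons, max_le_iff, ih, List.suffix_cons_iff]
    constructor
    · rintro ⟨h, h'⟩ s (rfl | hs)
      · exact h'
      · exact h s hs
    · intro h
      exact ⟨fun s hs => h s (Or.inr hs), h (a :: w) (Or.inl rfl)⟩

/-! ### Invariance under Knuth equivalence -/

theorem KnuthTransposition.weight_eq {u v : Word} (h : KnuthTransposition u v) :
    weight u = weight v := by
  cases h <;> simp <;> ring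

theorem KnuthTransposition.height_eq {u v : Word} (h : KnuthTransposition u v) :
    height u = height v := by
  -- Only whether each letter is `1`, `2` or larger matters. These order facts rule out the
  -- impossible patterns, leaving a finite check on the three-letter factor; `height_append` handles
  -- the context.
  have two_le {a b : ℕ+} (h : a < b) : b ≠ 1 := by
    rintro rfl
    exact not_lt_one h
  have eq_one {a b : ℕ+} (h : a < b) (hb : b = 2) : a = 1 := by
    subst hb
    exact le_antisymm (PNat.lt_add_one_iff.1 h) one_le
  cases h with
  | first x y a b c hab hbc =>
    have hc := two_le hbc
    have hb := eq_one hbc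
    have ha : b = 1 → a = 1 := by
      rintro rfl
      exact le_antisymm hab one_le
    have key : height [a, c, b] = height [c, a, b] := by
      simp only [height_cons, weight_cons, height_nil, weight_nil, letterWeight]
      split_ifs <;> first | omega | simp_all
    simp only [height_append, key]
    simp only [weight_cons]
    congr 2
    ring_nf
  | second x y a b c hab hbc =>
    have hb := two_le hab
    have hc := two_le (lt_of_lt_of_le hab hbc)
    have ha := eq_one (lt_of_lt_of_le hab hbc)
    have hb2 : c = 2 → b = 2 := by
      rintro rfl
      exact le_antisymm hbc (PNat.add_one_le_iff.2 (lt_of_le_of_ne one_le hb.symm))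
    have ha' := eq_one hab
    have key : height [b, a, c] = height [b, c, a] := by
      simp only [height_cons, weight_cons, height_nil, weight_nil, letterWeight]
      split_ifs <;> first | omega | simp_all
    simp only [height_append, key]
    simp only [weight_cons]
    congr 2
    ring_nf

theorem KnuthEquiv.weight_eq {u v : Word} (h : KnuthEquiv u v) : weight u = weight v := by
  induction h with
  | rel _ _ h => exact h.weight_eq
  | refl => rfl
  | symm _ _ _ ih => exact ih.symm
  | trans _ _ _ _ _ ih ih' => exact ih.trans ih'

theorem KnuthEquiv.height_eq {u v : Word} (h : KnuthEquiv u v) : height u = height v := by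
  induction h with
  | rel _ _ h => exact h.height_eq
  | refl => rfl
  | symm _ _ _ ih => exact ih.symm
  | trans _ _ _ _ _ ih ih' => exact ih.trans ih'

/-! ### Knuth equivalence is a congruence, and `21` commutes with words over `{1, 2}` -/

theorem KnuthEquiv.refl (u : Word) : KnuthEquiv u u := Relation.EqvGen.refl u

theorem KnuthEquiv.symm {u v : Word} (h : KnuthEquiv u v) : KnuthEquiv v u :=
  Relation.EqvGen.symm _ _ h

theorem KnuthEquiv.trans {u v w : Word} (h : KnuthEquiv u v) (h' : KnuthEquiv v w) :
    KnuthEquiv u w :=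
  Relation.EqvGen.trans _ _ _ h h'

theorem KnuthTransposition.context {u v : Word} (h : KnuthTransposition u v) (p q : Word) :
    KnuthTransposition (p ++ u ++ q) (p ++ v ++ q) := by
  cases h with
  | first x y a b c hab hbc =>
    simpa using KnuthTransposition.first (p ++ x) (y ++ q) a b c hab hbc
  | second x y a b c hab hbc =>
    simpa using KnuthTransposition.second (p ++ x) (y ++ q) a b c hab hbc

theorem KnuthEquiv.context {u v : Word} (h : KnuthEquiv u v) (p q : Word) :
    KnuthEquiv (p ++ u ++ q) (p ++ v ++ q) := by
  induction h with
  | rel _ _ h => exact Relation.EqvGen.rel _ _ (h.context p q)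
  | refl => exact KnuthEquiv.refl _
  | symm _ _ _ ih => exact ih.symm
  | trans _ _ _ _ _ ih ih' => exact ih.trans ih'

theorem KnuthEquiv.append_left {u v : Word} (h : KnuthEquiv u v) (p : Word) :
    KnuthEquiv (p ++ u) (p ++ v) := by
  simpa using h.context p []

theorem KnuthEquiv.append_right {u v : Word} (h : KnuthEquiv u v) (q : Word) :
    KnuthEquiv (u ++ q) (v ++ q) := by
  simpa using h.context [] q

/-- These are the Knuth relations with a repeated letter: `121 ≡ 211` and `212 ≡ 221`. -/
theorem KnuthEquiv.letter_commute {a : ℕ+} (ha : a = 1 ∨ a = 2) :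
    KnuthEquiv ([a] ++ [2, 1]) ([2, 1] ++ [a]) := by
  rcases ha with rfl | rfl
  · exact Relation.EqvGen.rel _ _
      (KnuthTransposition.first [] [] 1 1 2 le_rfl (by decide))
  · exact (Relation.EqvGen.rel _ _
      (KnuthTransposition.second [] [] 1 2 2 (by decide) le_rfl)).symm

/-- The word `2121…21` with `k` factors `21`. -/
def columns : ℕ → Word
  | 0 => []
  | k + 1 => [2, 1] ++ columns k

theorem KnuthEquiv.letter_commute_columns {a : ℕ+} (ha : a = 1 ∨ a = 2) (k : ℕ) :
    KnuthEquiv ([a] ++ columns k) (columns k ++ [a]) := by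
  induction k with
  | zero => exact KnuthEquiv.refl _
  | succ k ih =>
    have h₁ := (KnuthEquiv.letter_commute ha).append_right (columns k)
    have h₂ := ih.append_left [2, 1]
    simp only [columns, List.append_assoc] at h₁ h₂ ⊢
    exact h₁.trans h₂

/-- The representative of the class of a word over `{1, 2}`. -/
def normalForm (k i j : ℕ) : Word :=
  columns k ++ (List.replicate i 1 ++ List.replicate j 2)

/-- A prepended letter slides past the columns. A `1` then joins the `1`s; a `2` either pairs with
the first `1` into a new column or, if there is none, joins the `2`s. -/
theorem exists_knuthEquiv_normalForm (w : Word) (hw : ∀ a ∈ w, a = 1 ∨ a = 2) :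
    ∃ k i j, KnuthEquiv w (normalForm k i j) := by
  induction w with
  | nil => exact ⟨0, 0, 0, KnuthEquiv.refl _⟩
  | cons a w ih =>
    have ha : a = 1 ∨ a = 2 := hw a (by simp)
    obtain ⟨k, i, j, h⟩ := ih fun b hb => hw b (by simp [hb])
    have h' : KnuthEquiv (a :: w)
        (columns k ++ [a] ++ (List.replicate i 1 ++ List.replicate j 2)) := by
      have h₁ := h.append_left [a]
      have h₂ := (KnuthEquiv.letter_commute_columns ha k).append_right
        (List.replicate i 1 ++ List.replicate j 2)
      simp only [normalForm, List.append_assoc] at h₁ h₂ ⊢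
      exact h₁.trans h₂
    rcases ha with rfl | rfl
    · exact ⟨k, i + 1, j, by simpa [normalForm, List.replicate_succ] using h'⟩
    · cases i with
      | zero => exact ⟨k, 0, j + 1, by simpa [normalForm, List.replicate_succ] using h'⟩
      | succ i =>
        refine ⟨k + 1, i, j, h'.trans ?_⟩
        have hcomm : KnuthEquiv (columns k ++ [2, 1]) ([2, 1] ++ columns k) := by
          have h₁ := (KnuthEquiv.letter_commute_columns (Or.inr rfl) k).symm.append_right [1]
          have h₂ := (KnuthEquiv.letter_commute_columns (Or.inl rfl) k).symm.append_left [2]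
          simp only [List.append_assoc, List.cons_append, List.nil_append] at h₁ h₂ ⊢
          exact h₁.trans h₂
        simpa [normalForm, columns, List.replicate_succ] using
          hcomm.append_right (List.replicate i 1 ++ List.replicate j 2)

@[simp] theorem weight_columns (k : ℕ) : weight (columns k) = 0 := by
  induction k with
  | zero => rfl
  | succ k ih => simp [columns, ih]

@[simp] theorem height_columns (k : ℕ) : height (columns k) = 0 := by
  induction k with
  | zero => rfl
  | succ k ih => simp [columns, ih]

theorem weight_replicate (n : ℕ) (a : ℕ+) :
    weight (List.replicate n a) = n * letterWeight a := by
  induction n with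
  | zero => simp
  | succ n ih =>
    simp only [List.replicate_succ, weight_cons, ih, Nat.cast_succ]
    ring

theorem height_replicate_one (n : ℕ) : height (List.replicate n 1) = 0 := by
  induction n with
  | zero => rfl
  | succ n ih =>
    simp only [List.replicate_succ, height_cons, ih, weight_replicate, letterWeight_one]
    omega

theorem height_replicate_two (n : ℕ) : height (List.replicate n 2) = n := by
  induction n with
  | zero => rfl
  | succ n ih =>
    simp only [List.replicate_succ, height_cons, ih, weight_replicate, letterWeight_two]
    omega

theorem weight_normalForm (k i j : ℕ) : weight (normalForm k i j) = j - i := by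
  simp only [normalForm, weight_append, weight_columns, weight_replicate, letterWeight_one,
    letterWeight_two]
  ring

theorem height_normalForm (k i j : ℕ) : height (normalForm k i j) = j := by
  simp only [normalForm, height_append, weight_append, height_columns, weight_replicate,
    height_replicate_one, height_replicate_two, letterWeight_one, letterWeight_two]
  omega

/-! ### The centralizers of the letters `1` and `2` -/

/-- A centralizer is a union of Knuth classes, so membership may be tested on normal forms. -/
theorem mem_centralizer_of_knuthEquiv {u v w : Word} (h : KnuthEquiv w v)
    (hv : v ∈ centralizer u) : w ∈ centralizer u :=
  ((h.append_left u).trans hv).trans (h.append_right u).symm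

theorem columns_append_replicate_mem_centralizer {a : ℕ+} (ha : a = 1 ∨ a = 2) (k i : ℕ) :
    columns k ++ List.replicate i a ∈ centralizer [a] := by
  have h := (KnuthEquiv.letter_commute_columns ha k).append_right (List.replicate i a)
  have hrep : [a] ++ List.replicate i a = List.replicate i a ++ [a] := by
    rw [← List.replicate_succ', List.replicate_succ, List.singleton_append]
  rw [List.append_assoc, List.append_assoc, hrep, ← List.append_assoc (columns k)] at h
  exact h

/-- Prepending `1` keeps the height, while appending `1` lowers it by one unless it is already `0`.
-/
theorem mem_centralizer_one_iff {w : Word} (hw : ∀ a ∈ w, a = 1 ∨ a = 2) :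
    w ∈ centralizer [1] ↔ height w = 0 := by
  constructor
  · intro h
    have h := KnuthEquiv.height_eq h
    have h₀ := height_nonneg w
    have h₁ := weight_le_height w
    simp only [height_append, weight_cons, height_cons, letterWeight_one, height_nil,
      weight_nil] at h
    omega
  · intro h
    obtain ⟨k, i, j, hk⟩ := exists_knuthEquiv_normalForm w hw
    have hj : j = 0 := by
      have := hk.height_eq
      rw [h, height_normalForm] at this
      exact_mod_cast this.symm
    subst hj
    refine mem_centralizer_of_knuthEquiv hk ?_
    simpa [normalForm] using columns_append_replicate_mem_centralizer (Or.inl rfl) k i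

/-- Appending `2` always raises the height by one; prepending `2` does so only if the whole word
attains the height. -/
theorem mem_centralizer_two_iff {w : Word} (hw : ∀ a ∈ w, a = 1 ∨ a = 2) :
    w ∈ centralizer [2] ↔ height w - weight w = 0 := by
  constructor
  · intro h
    have h := KnuthEquiv.height_eq h
    have h₀ := height_nonneg w
    have h₁ := weight_le_height w
    simp only [height_append, weight_cons, height_cons, letterWeight_two, height_nil,
      weight_nil] at h
    omega
  · intro h
    obtain ⟨k, i, j, hk⟩ := exists_knuthEquiv_normalForm w hw
    have hi : i = 0 := by
      rw [hk.height_eq, hk.weight_eq, height_normalForm, weight_normalForm] at h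
      omega
    subst hi
    refine mem_centralizer_of_knuthEquiv hk ?_
    simpa [normalForm] using columns_append_replicate_mem_centralizer (Or.inr rfl) k j

/-! ### Words over `{1, 2}` -/

theorem PNat.le_two_iff (a : ℕ+) : (a : ℕ) ≤ 2 ↔ a = 1 ∨ a = 2 := by
  have := a.pos
  rw [← PNat.coe_inj, ← PNat.coe_inj]
  simp only [PNat.val_ofNat]
  omega

theorem mem_words_two_iff {n : ℕ} {w : Word} :
    w ∈ words n 2 ↔ w.length = n ∧ ∀ a ∈ w, a = 1 ∨ a = 2 := by
  simp only [words, Set.mem_ofPred_eq, PNat.le_two_iff]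

theorem isYamanouchi_iff {w : Word} (hw : ∀ a ∈ w, a = 1 ∨ a = 2) :
    IsYamanouchi w ↔ height w = 0 := by
  rw [(height_nonneg w).ge_iff_eq'.symm, height_le_zero_iff]
  constructor
  · intro h s hs
    have h₁ : s.count 2 ≤ s.count 1 := h s hs 1
    rw [weight_eq_count_sub_count]
    omega
  · intro h s hs i
    by_cases hi : i = 1
    · subst hi
      have := h s hs
      rw [weight_eq_count_sub_count] at this
      change s.count 2 ≤ s.count 1
      omega
    -- For `i ≥ 2` the letter `i + 1` exceeds `2`, so it does not occur.
    · rw [List.count_eq_zero_of_not_mem]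
      · exact Nat.zero_le _
      · intro hmem
        rcases hw _ (hs.subset hmem) with h1 | h2
        · exact (PNat.lt_add_left 1 i).ne' h1
        · exact hi (add_right_cancel (h2.trans (by decide : (2 : ℕ+) = 1 + 1)))

/-! ### Counting -/

/-- The words over `{1, 2}` of length `n` whose largest weight of the negative of a prefix
is `h`. -/
def depthWords (n h : ℕ) : Set Word :=
  {w ∈ words n 2 | height w - weight w = h}

theorem finite_words_two (n : ℕ) : (words n 2).Finite := by
  induction n with
  | zero =>
    refine (Set.finite_singleton []).subset fun w hw => ?_
    exact List.length_eq_zero_iff.1 hw.1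
  | succ n ih =>
    refine (ih.image (List.cons 1) |>.union (ih.image (List.cons 2))).subset fun w hw => ?_
    rw [mem_words_two_iff] at hw
    obtain ⟨a, v, rfl⟩ := List.exists_cons_of_length_eq_add_one hw.1
    have hv : v ∈ words n 2 :=
      mem_words_two_iff.2 ⟨by simpa using hw.1, fun b hb => hw.2 b (by simp [hb])⟩
    rcases hw.2 a (by simp) with rfl | rfl
    · exact Or.inl ⟨v, hv, rfl⟩
    · exact Or.inr ⟨v, hv, rfl⟩

theorem finite_depthWords (n h : ℕ) : (depthWords n h).Finite :=
  (finite_words_two n).subset fun _ hw => hw.1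

/-- Prepending `1` sends depth `d` to `d + 1`, and prepending `2` sends it to `max (d - 1) 0`; hence
depth `0` is reached by a `2` from both `1` and `0`. Depth is counted rather than height because it
alone determines its value after prepending. -/
theorem cons_mem_depthWords_iff {n h : ℕ} {a : ℕ+} {w : Word} :
    a :: w ∈ depthWords (n + 1) h ↔
      a = 1 ∧ (∃ h', h = h' + 1 ∧ w ∈ depthWords n h') ∨
      a = 2 ∧ (w ∈ depthWords n (h + 1) ∨ h = 0 ∧ w ∈ depthWords n 0) := by
  have hle := weight_le_height w
  have h12 : (1 : ℕ+) ≠ 2 := by decide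
  simp only [depthWords, Set.mem_ofPred_eq, mem_words_two_iff, List.length_cons,
    List.mem_cons, forall_eq_or_imp, height_cons, weight_cons, Nat.add_right_cancel_iff]
  constructor
  · rintro ⟨⟨hl, ha | ha, hw⟩, hh⟩
    · subst ha
      simp only [letterWeight_one] at hh
      exact Or.inl ⟨rfl, h - 1, by omega, ⟨hl, hw⟩, by omega⟩
    · subst ha
      simp only [letterWeight_two] at hh
      refine Or.inr ⟨rfl, ?_⟩
      by_cases hz : height w = weight w
      · exact Or.inr ⟨by omega, ⟨hl, hw⟩, by simp [hz]⟩
      · exact Or.inl ⟨⟨hl, hw⟩, by push_cast; omega⟩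
  · rintro (⟨rfl, h', rfl, ⟨hl, hw⟩, hh⟩ | ⟨rfl, ⟨⟨hl, hw⟩, hh⟩ | ⟨rfl, ⟨hl, hw⟩, hh⟩⟩)
    · refine ⟨⟨hl, Or.inl rfl, hw⟩, ?_⟩
      rw [letterWeight_one]
      push_cast
      omega
    · refine ⟨⟨hl, Or.inr rfl, hw⟩, ?_⟩
      rw [letterWeight_two]
      push_cast at hh
      omega
    · refine ⟨⟨hl, Or.inr rfl, hw⟩, ?_⟩
      rw [letterWeight_two]
      push_cast at hh ⊢
      omega

theorem nil_notMem_depthWords (n h : ℕ) : [] ∉ depthWords (n + 1) h := by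
  rintro ⟨h, -⟩
  exact Nat.succ_ne_zero _ h.1.symm

theorem ncard_image_cons (a : ℕ+) (s : Set Word) : (List.cons a '' s).ncard = s.ncard :=
  Set.ncard_image_of_injective s List.cons_injective

theorem ncard_depthWords_succ_zero (n : ℕ) :
    (depthWords (n + 1) 0).ncard = (depthWords n 0).ncard + (depthWords n 1).ncard := by
  have h : depthWords (n + 1) 0 = List.cons 2 '' (depthWords n 0 ∪ depthWords n 1) := by
    ext w
    cases w with
    | nil => simp [nil_notMem_depthWords]
    | cons a w =>
      rw [cons_mem_depthWords_iff]
      simp [or_comm, eq_comm]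
      tauto
  rw [h, ncard_image_cons, Set.ncard_union_eq _ (finite_depthWords _ _) (finite_depthWords _ _)]
  refine Set.disjoint_left.2 fun w h₀ h₁ => ?_
  exact absurd (h₀.2.symm.trans h₁.2) (by simp)

theorem ncard_depthWords_succ_succ (n h : ℕ) :
    (depthWords (n + 1) (h + 1)).ncard =
      (depthWords n h).ncard + (depthWords n (h + 2)).ncard := by
  have heq : depthWords (n + 1) (h + 1) =
      List.cons 1 '' depthWords n h ∪ List.cons 2 '' depthWords n (h + 2) := by
    ext w
    cases w with
    | nil => simp [nil_notMem_depthWords]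
    | cons a w =>
      rw [cons_mem_depthWords_iff]
      simp [eq_comm, and_comm]
  rw [heq, Set.ncard_union_eq _ ((finite_depthWords _ _).image _) ((finite_depthWords _ _).image _),
    ncard_image_cons, ncard_image_cons]
  refine Set.disjoint_left.2 ?_
  rintro _ ⟨u, -, rfl⟩ ⟨v, -, huv⟩
  exact absurd (List.cons.inj huv).1 (by decide)

theorem choose_succ_div_two (n : ℕ) : n.choose ((n + 1) / 2) = n.choose (n / 2) :=
  Nat.choose_symm_of_eq_add (by omega)

theorem ncard_depthWords (n h : ℕ) : (depthWords n h).ncard = n.choose ((n + h + 1) / 2) := by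
  induction n generalizing h with
  | zero =>
    cases h with
    | zero =>
      have : depthWords 0 0 = {[]} := by
        ext w
        simp only [depthWords, mem_words_two_iff, Set.mem_ofPred_eq, List.length_eq_zero_iff,
          Set.mem_singleton_iff]
        constructor
        · exact fun h => h.1.1
        · rintro rfl
          simp
      simp [this]
    | succ h =>
      have : depthWords 0 (h + 1) = ∅ := by
        ext w
        simp only [depthWords, mem_words_two_iff, Set.mem_ofPred_eq, List.length_eq_zero_iff,
          Set.mem_empty_iff_false, iff_false]
        rintro ⟨⟨rfl, -⟩, h'⟩
        simp only [height_nil, weight_nil] at h'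
        omega
      rw [this, Set.ncard_empty, Nat.choose_eq_zero_of_lt (by omega)]
  | succ n ih =>
    cases h with
    | zero =>
      -- At the boundary Pascal's rule needs the symmetry of the central binomial coefficients.
      rw [ncard_depthWords_succ_zero, ih, ih, show (n + 1 + 0 + 1) / 2 = n / 2 + 1 by omega,
        Nat.choose_succ_succ, add_zero, choose_succ_div_two]
    | succ h =>
      rw [ncard_depthWords_succ_succ, ih, ih,
        show (n + 1 + (h + 1) + 1) / 2 = (n + h + 1) / 2 + 1 by omega,
        Nat.choose_succ_succ, show (n + (h + 2) + 1) / 2 = (n + h + 1) / 2 + 1 by omega]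

theorem ncard_depth_eq_zero (n : ℕ) :
    {w ∈ words n 2 | height w - weight w = 0}.ncard = n.choose (n / 2) := by
  rw [← choose_succ_div_two]
  exact ncard_depthWords n 0

/-- Reverse a word and exchange the letters `1` and `2`. -/
def reverseSwap (w : Word) : Word := (w.map (Equiv.swap 1 2)).reverse

theorem reverseSwap_involutive : Function.Involutive reverseSwap := by
  intro w
  simp [reverseSwap, List.map_reverse, Function.comp_def]

theorem reverseSwap_cons (a : ℕ+) (w : Word) :
    reverseSwap (a :: w) = reverseSwap w ++ [Equiv.swap 1 2 a] := by
  simp [reverseSwap]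

theorem letterWeight_swap (a : ℕ+) : letterWeight (Equiv.swap 1 2 a) = -letterWeight a := by
  by_cases h1 : a = 1
  · subst h1
    simp
  · by_cases h2 : a = 2
    · subst h2
      simp
    · rw [Equiv.swap_apply_of_ne_of_ne h1 h2]
      simp [letterWeight, h1, h2]

/-- Prefixes become suffixes with negated weight, so height and depth are exchanged. -/
theorem height_reverseSwap (w : Word) : height (reverseSwap w) = height w - weight w := by
  induction w with
  | nil => rfl
  | cons a w ih =>
    have := weight_le_height w
    simp only [reverseSwap_cons, height_append, height_cons, weight_cons, height_nil,
      weight_nil, letterWeight_swap, ih]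
    omega

theorem reverseSwap_mem_words {n : ℕ} {w : Word} (hw : w ∈ words n 2) :
    reverseSwap w ∈ words n 2 := by
  rw [mem_words_two_iff] at hw ⊢
  refine ⟨by simpa [reverseSwap] using hw.1, ?_⟩
  simp only [reverseSwap, List.mem_reverse, List.mem_map]
  rintro _ ⟨b, hb, rfl⟩
  rcases hw.2 b hb with rfl | rfl <;> simp

theorem ncard_height_eq_zero (n : ℕ) :
    {w ∈ words n 2 | height w = 0}.ncard = n.choose (n / 2) := by
  rw [← ncard_depth_eq_zero, ← Set.ncard_image_of_injective _ reverseSwap_involutive.injective]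
  congr 1
  ext w
  constructor
  · rintro ⟨v, ⟨hv, h⟩, rfl⟩
    refine ⟨reverseSwap_mem_words hv, ?_⟩
    rw [← height_reverseSwap, reverseSwap_involutive, h]
  · rintro ⟨hw, h⟩
    exact ⟨reverseSwap w, ⟨reverseSwap_mem_words hw, by rw [height_reverseSwap, h]⟩,
      reverseSwap_involutive w⟩

end KnuthCentralizer

open KnuthCentralizer in
theorem mainTheorem9 (n : ℕ) :
    KnuthCentralizer.centralizerCount n 2 [1] = n.choose (n / 2) ∧
    KnuthCentralizer.centralizerCount n 2 [2] = n.choose (n / 2) ∧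
    {w ∈ KnuthCentralizer.words n 2 | KnuthCentralizer.IsYamanouchi w}.ncard
      = n.choose (n / 2) := by
  refine ⟨?_, ?_, ?_⟩
  · rw [← ncard_height_eq_zero, centralizerCount, Set.inter_comm]
    congr 1
    ext w
    exact and_congr_right fun hw => mem_centralizer_one_iff (mem_words_two_iff.1 hw).2
  · rw [← ncard_depth_eq_zero, centralizerCount, Set.inter_comm]
    congr 1
    ext w
    exact and_congr_right fun hw => mem_centralizer_two_iff (mem_words_two_iff.1 hw).2
  · rw [← ncard_height_eq_zero]
    congr 1
    ext w
    exact and_congr_right fun hw => isYamanouchi_iff (mem_words_two_iff.1 hw).2
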